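/- Let $[n]=\{1,\dots,n\}$, let $U$ be the uniform distribution on $[n]$, and let $d_{TV}(P,Q)=\frac12\sum_{i\in[n]}|P(i)-Q(i)|$. For every constant $c>0$ there is a constant $C>0$, depending only on $c$, such that for all integers $n\ge 1$, $k\ge 2$ and all $\varepsilon\in(0,1]$ there are $s_1,s_2\in\mathbb{N}$ and a (possibly randomized) algorithm, depending only on $n,k,\varepsilon$ (and $c$), with the following properties. Given $s_1$ samples from a distribution $P$ on $[n]$ and $s_2$ samples from each of $k$ distributions $D_1,\dots,D_k$ on $[n]$, all samples being independent, it outputs a subset of $\{1,\dots,k\}$. (1) Correctness: for every distribution $P$ on $[n]$ with $d_{TV}(P,U)\ge\varepsilon$ and every set $\chi\subseteq\{1,\dots,k\}$, if $D_i=P$ for $i\in\chi$ and $D_i=U$ for $i\notin\chi$, then the output equals $\chi$ with probability at least $8/9$, i.e. all $k$ distributions are simultaneously classified correctly as $P$ or $U$. The algorithm knows neither $P$ nor $\chi$. (2) Sample complexity: the total number of samples $s_1+k s_2$ satisfies $$s_1+k s_2\;\le\;\begin{cases} C\,\dfrac{\sqrt{nk\log k}}{\varepsilon^2} & \text{if }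 n\ge c\,k\log k,\\[2ex] C\,\dfrac{k\log k}{\varepsilon^2} & \text{if } n\le c\,k\log k.\end{cases}$$ -/

import Mathlib

open MeasureTheory
open scoped ENNReal

noncomputable section

/-- Total variation distance `(1/2) ∑ᵢ |P i - Q i|` of two distributions on `[n]`
(modelled as `Fin n`). -/
def tvDist {n : ℕ} (P Q : PMF (Fin n)) : ℝ :=
  (1 / 2) * ∑ i, |(P i).toReal - (Q i).toReal|

/-- The uniform distribution on `[n]`, `n ≥ 1`. -/
def unif (n : ℕ) [NeZero n] : PMF (Fin n) :=
  PMF.uniformOfFintype (Fin n)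

/-- The `k` distributions determined by a hidden set `χ ⊆ [k]`: `D i = P` for `i ∈ χ`, and
`D i` is uniform for `i ∉ χ`. -/
def instanceDist {n k : ℕ} [NeZero n] (P : PMF (Fin n)) (χ : Finset (Fin k)) :
    Fin k → PMF (Fin n) :=
  fun i => if i ∈ χ then P else unif n

/-- A sampling algorithm for classifying `k` distributions over `[n]`, given sample access to them
and to one further distribution `P`.  It draws `s₁` samples from `P` and `s₂` samples from each of
the `k` distributions, and from these data alone (and internal randomness) it outputs a subset of
`[k]`: the indices that it classifies as `P`, all others being classified as uniform. -/
structure Classifier (n k : ℕ) where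
  /-- number of samples drawn from `P` -/
  s₁ : ℕ
  /-- number of samples drawn from each of the `k` distributions -/
  s₂ : ℕ
  /-- the law of the output, given the observed samples -/
  output : (Fin s₁ → Fin n) × (Fin k → Fin s₂ → Fin n) → PMF (Finset (Fin k))

namespace Classifier

variable {n k : ℕ}

/-- Total number of samples drawn. -/
def samples (A : Classifier n k) : ℕ := A.s₁ + k * A.s₂

/-- Joint law of the samples: all of them are independent, `s₁` of them drawn from `P` and `s₂`
drawn from each `D i`. -/
def dataLaw (A : Classifier n k) (P : PMF (Fin n)) (D : Fin k → PMF (Fin n)) :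
    Measure ((Fin A.s₁ → Fin n) × (Fin k → Fin A.s₂ → Fin n)) :=
  (Measure.pi fun _ : Fin A.s₁ => P.toMeasure).prod
    (Measure.pi fun i : Fin k => Measure.pi fun _ : Fin A.s₂ => (D i).toMeasure)

/-- The probability, over the samples and the internal randomness, that the algorithm outputs
exactly the hidden set `χ`. -/
def successProb [NeZero n] (A : Classifier n k) (P : PMF (Fin n)) (χ : Finset (Fin k)) : ℝ≥0∞ :=
  ∫⁻ x, A.output x χ ∂(A.dataLaw P (instanceDist P χ))

end Classifier

end

/-!
A test function `f` whose mean under `P` exceeds its mean under the uniform distribution by several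
standard deviations of an `m`-sample average turns a batch of `m` samples into a constant-error
test (Chebyshev), and the majority vote of `O(log k)` batches errs with probability `O(1 / k)`; one
such `f` therefore serves all `k` distributions.

It can be learnt from `P` alone. With `p`, `q` the empirical frequencies of two samples of size
`s` and `τ = max (1 / n) (1 / s)`, take `f i = (q i - 1 / n) / (τ + p i)`. Its mean gap
concentrates around `∑ (P i - 1 / n) ^ 2 / (τ + p i)`, which by Cauchy–Schwarz is at least
`2 ε ^ 2 / (n τ)`, while the denominators keep the second moments small even where `P` has heavy
atoms. This succeeds as soon as `m ε ^ 2` and `m s ε ^ 4 / n` exceed a constant, and balancing `s`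
against `k m log k` gives the two regimes.
-/

open ProbabilityTheory

/-- The joint law of `s` independent samples from `μ`. -/
noncomputable abbrev iidLaw {α : Type*} [MeasurableSpace α] (μ : Measure α) (s : ℕ) :
    Measure (Fin s → α) :=
  Measure.pi fun _ => μ

theorem measureReal_lt_le_of_integral_le {Ω : Type*} [MeasurableSpace Ω] {μ : Measure Ω}
    [IsFiniteMeasure μ] {Y : Ω → ℝ} {c δ : ℝ} (hY : 0 ≤ Y) (hint : Integrable Y μ) (hc : 0 ≤ c)
    (hδ : 0 ≤ δ) (h : ∫ x, Y x ∂μ ≤ δ * c) : μ.real {x | c < Y x} ≤ δ := by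
  rcases hc.eq_or_lt with rfl | hc
  · have hzero : ∫ x, Y x ∂μ = 0 := le_antisymm (by simpa using h) (integral_nonneg hY)
    have hnull : μ {x | 0 < Y x} = 0 := by
      refine measure_eq_zero_iff_ae_notMem.2 ?_
      filter_upwards [(integral_eq_zero_iff_of_nonneg hY hint).1 hzero] with x hx
      exact hx.le.not_gt
    rwa [measureReal_def, hnull]
  · refine le_of_mul_le_mul_left ?_ hc
    calc c * μ.real {x | c < Y x} ≤ c * μ.real {x | c ≤ Y x} := by
          gcongr with x
          · finiteness
          · exact le_of_lt
      _ ≤ ∫ x, Y x ∂μ := mul_meas_ge_le_integral_of_nonneg (ae_of_all _ hY) hint c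
      _ ≤ c * δ := by rwa [mul_comm]

theorem measureReal_prod_le_add {Ω Ω' : Type*} [MeasurableSpace Ω] [MeasurableSpace Ω']
    {μ : Measure Ω} {ν : Measure Ω'} [IsProbabilityMeasure μ] [IsProbabilityMeasure ν]
    {E : Set (Ω × Ω')} {B : Set Ω} {a b : ℝ} (hE : MeasurableSet E) (hB : MeasurableSet B)
    (ha : μ.real B ≤ a) (hb : 0 ≤ b) (h : ∀ x ∉ B, ν.real {y | (x, y) ∈ E} ≤ b) :
    (μ.prod ν).real E ≤ a + b := by
  have hsec : ∀ x, ν.real {y | (x, y) ∈ E} ≤ B.indicator 1 x + b := fun x => by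
    by_cases hx : x ∈ B
    · simpa [hx] using add_le_add (measureReal_le_one (μ := ν)) hb
    · simpa [hx] using h x hx
  have hB1 : Integrable (B.indicator 1 : Ω → ℝ) μ := (integrable_const (1 : ℝ)).indicator hB
  calc (μ.prod ν).real E = ∫ x, ν.real {y | (x, y) ∈ E} ∂μ := by
        rw [measureReal_def, Measure.prod_apply hE]
        exact (integral_toReal (measurable_measure_prodMk_left hE).aemeasurable
          (ae_of_all _ fun _ => measure_lt_top _ _)).symm
    _ ≤ ∫ x, (B.indicator 1 x + b) ∂μ :=
        integral_mono_of_nonneg (ae_of_all _ fun _ => measureReal_nonneg)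
          (hB1.add (integrable_const b)) (ae_of_all _ hsec)
    _ = μ.real B + b := by
        rw [integral_add hB1 (integrable_const b), integral_indicator_one hB]
        simp
    _ ≤ a + b := by gcongr

section EmpiricalMean

variable {α : Type*} [MeasurableSpace α] {μ : Measure α} {s : ℕ} {g : α → ℝ}

/-- The average of `g` over the sample `x`; it is `0` for the empty sample. -/
noncomputable def empiricalMean (g : α → ℝ) (x : Fin s → α) : ℝ :=
  (∑ j, g (x j)) / s

variable [IsProbabilityMeasure μ]

theorem integral_empiricalMean (hs : s ≠ 0) (hg : Integrable g μ) :
    ∫ x, empiricalMean g x ∂iidLaw μ s = ∫ a, g a ∂μ := by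
  have hcoord : ∀ j : Fin s, Integrable (fun x : Fin s → α => g (x j)) (iidLaw μ s) := fun j =>
    integrable_comp_eval hg
  simp only [empiricalMean, integral_div, integral_finsetSum _ fun j _ => hcoord j,
    integral_comp_eval (μ := fun _ : Fin s => μ) hg.aestronglyMeasurable]
  simp [hs]

theorem memLp_empiricalMean (hg : MemLp g 2 μ) :
    MemLp (fun x : Fin s → α => empiricalMean g x) 2 (iidLaw μ s) := by
  have hsum : MemLp (fun x : Fin s → α => ∑ j, g (x j)) 2 (iidLaw μ s) :=
    memLp_finsetSum _ fun j _ => hg.comp_measurePreserving (measurePreserving_eval (fun _ => μ) j)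
  simpa only [empiricalMean, div_eq_inv_mul] using hsum.const_mul (s : ℝ)⁻¹

theorem variance_empiricalMean (hg : MemLp g 2 μ) :
    Var[fun x : Fin s → α => empiricalMean g x; iidLaw μ s] = Var[g; μ] / s := by
  have hsum : Var[fun x : Fin s → α => ∑ j, g (x j); iidLaw μ s] = s * Var[g; μ] := by
    simpa [Finset.sum_fn] using variance_sum_pi (μ := fun _ : Fin s => μ) fun _ => hg
  simp only [empiricalMean, div_eq_inv_mul, variance_const_mul, hsum]
  rcases eq_or_ne s 0 with rfl | hs
  · simp
  · field_simp

theorem integral_sub_sq_eq_variance_add {Ω : Type*} [MeasurableSpace Ω] {P : Measure Ω}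
    [IsProbabilityMeasure P] {X : Ω → ℝ} (hX : MemLp X 2 P) (r : ℝ) :
    ∫ ω, (X ω - r) ^ 2 ∂P = Var[X; P] + (∫ ω, X ω ∂P - r) ^ 2 := by
  have hsub : MemLp (fun ω => X ω - r) 2 P := hX.sub (memLp_const r)
  have h := variance_eq_sub hsub
  rw [variance_sub_const hX.aestronglyMeasurable,
    integral_sub (hX.integrable one_le_two) (integrable_const r)] at h
  simp only [integral_const, probReal_univ, one_smul] at h
  exact (sub_eq_iff_eq_add.1 h.symm)

theorem integral_empiricalMean_sub_sq_le (hs : s ≠ 0) (hg : MemLp g 2 μ) (r : ℝ) :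
    ∫ x, (empiricalMean g x - r) ^ 2 ∂iidLaw μ s ≤
      (∫ a, g a ^ 2 ∂μ) / s + (∫ a, g a ∂μ - r) ^ 2 := by
  rw [integral_sub_sq_eq_variance_add (memLp_empiricalMean hg), variance_empiricalMean hg,
    integral_empiricalMean hs (hg.integrable one_le_two)]
  gcongr
  exact variance_le_expectation_sq hg.aestronglyMeasurable

theorem measureReal_lt_empiricalMean_sub_sq_le (hs : s ≠ 0) (hg : MemLp g 2 μ) {c δ : ℝ}
    (hc : 0 ≤ c) (hδ : 0 ≤ δ) (h : ∫ a, g a ^ 2 ∂μ ≤ δ * (s * c)) :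
    (iidLaw μ s).real {x | c < (empiricalMean g x - ∫ a, g a ∂μ) ^ 2} ≤ δ := by
  have hs' : (0 : ℝ) < s := by positivity
  refine measureReal_lt_le_of_integral_le (fun x => sq_nonneg _)
    ((memLp_empiricalMean hg).sub (memLp_const _)).integrable_sq hc hδ ?_
  calc ∫ x, (empiricalMean g x - ∫ a, g a ∂μ) ^ 2 ∂iidLaw μ s ≤ (∫ a, g a ^ 2 ∂μ) / s := by
        simpa using integral_empiricalMean_sub_sq_le hs hg (∫ a, g a ∂μ)
    _ ≤ δ * c := by
        rw [div_le_iff₀ hs']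
        linarith

end EmpiricalMean

section EmpiricalFreq

variable {α : Type*} {s : ℕ}

/-- The number of occurrences of `i` in the sample `x`, as a real number. -/
noncomputable def occurrences (x : Fin s → α) (i : α) : ℝ :=
  ∑ j, ({i} : Set α).indicator 1 (x j)

/-- The empirical frequency of `i` in the sample `x`. -/
noncomputable def empiricalFreq (x : Fin s → α) (i : α) : ℝ :=
  empiricalMean (({i} : Set α).indicator 1) x

/-- The regularised inverse frequency `1 / (τ + #{j | x j = i} / s)`. -/
noncomputable def inverseFreq (τ : ℝ) (x : Fin s → α) (i : α) : ℝ :=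
  (τ + empiricalFreq x i)⁻¹

theorem occurrences_nonneg (x : Fin s → α) (i : α) : 0 ≤ occurrences x i :=
  Finset.sum_nonneg fun _ _ => Set.indicator_nonneg (fun _ _ => zero_le_one) _

theorem empiricalFreq_nonneg (x : Fin s → α) (i : α) : 0 ≤ empiricalFreq x i :=
  div_nonneg (occurrences_nonneg x i) s.cast_nonneg

theorem inverseFreq_pos {τ : ℝ} (hτ : 0 < τ) (x : Fin s → α) (i : α) : 0 < inverseFreq τ x i :=
  inv_pos.2 (add_pos_of_pos_of_nonneg hτ (empiricalFreq_nonneg x i))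

theorem inverseFreq_le_inv {τ : ℝ} (hτ : 0 < τ) (x : Fin s → α) (i : α) :
    inverseFreq τ x i ≤ τ⁻¹ :=
  inv_anti₀ hτ (le_add_of_nonneg_right (empiricalFreq_nonneg x i))

theorem sum_mul_empiricalFreq [Fintype α] (g : α → ℝ) (x : Fin s → α) :
    ∑ i, g i * empiricalFreq x i = empiricalMean g x := by
  classical
  simp only [empiricalFreq, empiricalMean, mul_div_assoc', ← Finset.sum_div, Finset.mul_sum]
  rw [Finset.sum_comm]
  simp [Set.indicator_apply]

section DiscreteMoments

variable [MeasurableSpace α] [MeasurableSingletonClass α] {μ : Measure α} [IsProbabilityMeasure μ]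

theorem memLp_indicator_singleton (i : α) : MemLp (({i} : Set α).indicator (1 : α → ℝ)) 2 μ :=
  memLp_indicator_const 2 (measurableSet_singleton i) 1 (.inr (measure_ne_top _ _))

theorem integral_empiricalFreq (hs : s ≠ 0) (i : α) :
    ∫ x, empiricalFreq x i ∂iidLaw μ s = μ.real {i} := by
  rw [← integral_indicator_one (measurableSet_singleton i)]
  exact integral_empiricalMean hs ((memLp_indicator_singleton i).integrable one_le_two)

theorem integral_empiricalFreq_sub_sq_le (hs : s ≠ 0) (i : α) (r : ℝ) :
    ∫ x, (empiricalFreq x i - r) ^ 2 ∂iidLaw μ s ≤ μ.real {i} / s + (μ.real {i} - r) ^ 2 := by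
  have hsq : (fun a => ({i} : Set α).indicator (1 : α → ℝ) a ^ 2) = ({i} : Set α).indicator 1 := by
    ext a
    by_cases ha : a ∈ ({i} : Set α) <;> simp [ha]
  have h := integral_empiricalMean_sub_sq_le hs (memLp_indicator_singleton (μ := μ) i) r
  rwa [hsq, integral_indicator_one (measurableSet_singleton i)] at h

theorem integral_indicator_mul_comp_occurrences (i : α) (φ : ℝ → ℝ) (j : Fin (s + 1)) :
    ∫ x, ({i} : Set α).indicator 1 (x j) * φ (occurrences x i) ∂iidLaw μ (s + 1) =
      μ.real {i} * ∫ x, φ (occurrences x i + 1) ∂iidLaw μ s := by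
  rw [← (measurePreserving_piFinSuccAbove (fun _ => μ) j).symm.integral_comp',
    ← integral_indicator_one (measurableSet_singleton i), ← integral_prod_mul]
  refine integral_congr_ae (ae_of_all _ fun ⟨a, y⟩ => ?_)
  by_cases ha : a = i
  · simp [occurrences, Fin.sum_univ_succAbove _ j, ha, add_comm]
  · simp [ha]

variable [Finite α]

theorem integral_occurrences_mul_comp_occurrences (i : α) (φ : ℝ → ℝ) :
    ∫ x, occurrences x i * φ (occurrences x i) ∂iidLaw μ (s + 1) =
      (s + 1) * μ.real {i} * ∫ x, φ (occurrences x i + 1) ∂iidLaw μ s := by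
  calc ∫ x, occurrences x i * φ (occurrences x i) ∂iidLaw μ (s + 1)
      = ∫ x, ∑ j, ({i} : Set α).indicator 1 (x j) * φ (occurrences x i) ∂iidLaw μ (s + 1) := by
        simp only [← Finset.sum_mul, occurrences]
    _ = ∑ _ : Fin (s + 1), μ.real {i} * ∫ x, φ (occurrences x i + 1) ∂iidLaw μ s := by
        rw [integral_finsetSum _ fun _ _ => Integrable.of_finite]
        simp only [integral_indicator_mul_comp_occurrences]
    _ = _ := by simp [mul_assoc]

theorem sq_mul_integral_inv_occurrences_le (i : α) :
    (s + 1) * (s + 2) * μ.real {i} ^ 2 *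
      ∫ x, ((occurrences x i + 1) * (occurrences x i + 2))⁻¹ ∂iidLaw μ s ≤ 1 := by
  have hone := integral_occurrences_mul_comp_occurrences (μ := μ) (s := s) i
    fun r => (r * (r + 1))⁻¹
  have htwo := integral_occurrences_mul_comp_occurrences (μ := μ) (s := s + 1) i
    fun r => (r - 1) * (r * (r - 1))⁻¹
  calc _ = (s + 2) * μ.real {i} * ∫ x, occurrences x i * (occurrences x i * (occurrences x i + 1))⁻¹
              ∂iidLaw μ (s + 1) := by
        rw [hone]
        simp only [add_assoc, one_add_one_eq_two]
        ring
    _ = ∫ x, occurrences x i * ((occurrences x i - 1) * (occurrences x i * (occurrences x i - 1))⁻¹)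
              ∂iidLaw μ (s + 2) := by
        rw [htwo]
        push_cast
        ring_nf
    _ ≤ ∫ _, 1 ∂iidLaw μ (s + 2) := by
        refine integral_mono .of_finite .of_finite fun x => ?_
        simpa only [mul_assoc] using mul_inv_le_one (a := occurrences x i * (occurrences x i - 1))
    _ = 1 := by simp

end DiscreteMoments

end EmpiricalFreq

theorem sq_sum_sq_div_le {ι : Type*} [Fintype ι] {w : ι → ℝ} (hw : ∀ i, 0 < w i) (d c : ι → ℝ) :
    (∑ i, d i ^ 2 / c i) ^ 2 ≤ (∑ i, w i * d i ^ 2) * ∑ i, (d i / c i) ^ 2 / w i := by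
  refine Finset.sum_sq_le_sum_mul_sum_of_sq_le_mul _
    (fun i _ => mul_nonneg (hw i).le (sq_nonneg _))
    (fun i _ => div_nonneg (sq_nonneg _) (hw i).le) fun i _ => Eq.le ?_
  have := (hw i).ne'
  field_simp

theorem le_div_of_sq_le_mul {σ S D δ : ℝ} (hσ : 0 ≤ σ) (hS : 0 ≤ S) (hδ : 0 ≤ δ)
    (hCS : σ ^ 2 ≤ S * D) (hD : D ≤ σ / δ) : σ ≤ S / δ := by
  rcases hσ.eq_or_lt with rfl | hσ
  · positivity
  · refine le_of_mul_le_mul_right ?_ hσ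
    calc σ * σ = σ ^ 2 := (sq σ).symm
      _ ≤ S * D := hCS
      _ ≤ S * (σ / δ) := by gcongr
      _ = S / δ * σ := by ring

theorem pos_and_pos_of_one_le_natCast_mul {s : ℕ} {τ : ℝ} (h : 1 ≤ s * τ) :
    0 < (s : ℝ) ∧ 0 < τ := by
  have hs : (0 : ℝ) < s := s.cast_nonneg.lt_of_ne' fun hs => by norm_num [hs] at h
  exact ⟨hs, pos_of_mul_pos_right (one_pos.trans_le h) hs.le⟩

section InverseFreq

variable {α : Type*} {s : ℕ} {τ : ℝ}

theorem inverseFreq_sq_le (hsτ : 1 ≤ s * τ) (x : Fin s → α) (i : α) :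
    inverseFreq τ x i ^ 2 ≤ 2 * s ^ 2 * ((occurrences x i + 1) * (occurrences x i + 2))⁻¹ := by
  obtain ⟨hs, hτ⟩ := pos_and_pos_of_one_le_natCast_mul hsτ
  have hN := occurrences_nonneg x i
  have hw : inverseFreq τ x i ≤ s * (occurrences x i + 1)⁻¹ := by
    rw [← div_eq_mul_inv, ← inv_div]
    refine inv_anti₀ (by positivity) ?_
    rw [div_le_iff₀ hs, add_mul, show empiricalFreq x i * s = occurrences x i from
      div_mul_cancel₀ _ hs.ne']
    linarith
  have hw0 : 0 ≤ inverseFreq τ x i := (inverseFreq_pos hτ x i).le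
  calc inverseFreq τ x i ^ 2 ≤ (s * (occurrences x i + 1)⁻¹) ^ 2 := by gcongr
    _ = 2 * s ^ 2 * ((occurrences x i + 1) * (2 * (occurrences x i + 1)))⁻¹ := by
        field_simp
    _ ≤ _ := by
        gcongr
        linarith

variable [MeasurableSpace α] [MeasurableSingletonClass α] {μ : Measure α} [IsProbabilityMeasure μ]

theorem mul_integral_inverseFreq_sq_le [Finite α] (hsτ : 1 ≤ s * τ) (i : α) :
    μ.real {i} * ∫ x, inverseFreq τ x i ^ 2 ∂iidLaw μ s ≤ 4 / (τ + μ.real {i}) := by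
  obtain ⟨hs, hτ⟩ := pos_and_pos_of_one_le_natCast_mul hsτ
  rcases le_total (μ.real {i}) τ with hpτ | hpτ
  · have hw : ∫ x, inverseFreq τ x i ^ 2 ∂iidLaw μ s ≤ ∫ _, (τ⁻¹) ^ 2 ∂iidLaw μ s := by
      refine integral_mono .of_finite .of_finite fun x => ?_
      exact pow_le_pow_left₀ (inverseFreq_pos hτ x i).le (inverseFreq_le_inv hτ x i) 2
    calc μ.real {i} * ∫ x, inverseFreq τ x i ^ 2 ∂iidLaw μ s ≤ τ * (τ⁻¹) ^ 2 := by
          gcongr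
          simpa using hw
      _ = 4 / (τ + 3 * τ) := by field_simp; norm_num
      _ ≤ 4 / (τ + μ.real {i}) := by gcongr; linarith
  · have hp : 0 < μ.real {i} := hτ.trans_le hpτ
    have hsize := sq_mul_integral_inv_occurrences_le (μ := μ) (s := s) i
    set I := ∫ x, ((occurrences x i + 1) * (occurrences x i + 2))⁻¹ ∂iidLaw μ s
    have hI : 0 ≤ I := integral_nonneg fun x =>
      have := occurrences_nonneg x i
      by positivity
    have hw : ∫ x, inverseFreq τ x i ^ 2 ∂iidLaw μ s ≤ 2 * s ^ 2 * I := by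
      rw [← integral_const_mul]
      exact integral_mono .of_finite .of_finite fun x => inverseFreq_sq_le hsτ x i
    rw [le_div_iff₀ (by positivity)]
    calc μ.real {i} * (∫ x, inverseFreq τ x i ^ 2 ∂iidLaw μ s) * (τ + μ.real {i})
        ≤ μ.real {i} * (2 * ((s + 1) * (s + 2)) * I) * (μ.real {i} + μ.real {i}) := by
          gcongr
          refine hw.trans ?_
          gcongr
          nlinarith
      _ = 4 * ((s + 1) * (s + 2) * μ.real {i} ^ 2 * I) := by ring
      _ ≤ 4 := by linarith

variable [Fintype α]

theorem integral_sum_sq_div_inverseFreq (hsτ : 1 ≤ s * τ) (d : α → ℝ) :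
    ∫ x, ∑ i, (d i / (τ + μ.real {i})) ^ 2 / inverseFreq τ x i ∂iidLaw μ s =
      ∑ i, d i ^ 2 / (τ + μ.real {i}) := by
  obtain ⟨hs, hτ⟩ := pos_and_pos_of_one_le_natCast_mul hsτ
  rw [integral_finsetSum _ fun _ _ => .of_finite]
  refine Finset.sum_congr rfl fun i _ => ?_
  have hτp : τ + μ.real {i} ≠ 0 := (add_pos_of_pos_of_nonneg hτ measureReal_nonneg).ne'
  simp only [inverseFreq, div_inv_eq_mul]
  rw [integral_const_mul, integral_add .of_finite .of_finite,
    integral_empiricalFreq (by exact_mod_cast hs.ne'), integral_const, probReal_univ, one_smul]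
  field_simp

theorem integral_sum_mul_inverseFreq_sq_le (hsτ : 1 ≤ s * τ) (d : α → ℝ) :
    ∫ x, ∑ i, μ.real {i} * inverseFreq τ x i ^ 2 * d i ^ 2 ∂iidLaw μ s ≤
      4 * ∑ i, d i ^ 2 / (τ + μ.real {i}) := by
  rw [integral_finsetSum _ fun _ _ => .of_finite, Finset.mul_sum]
  refine Finset.sum_le_sum fun i _ => ?_
  rw [integral_mul_const, integral_const_mul]
  calc μ.real {i} * (∫ x, inverseFreq τ x i ^ 2 ∂iidLaw μ s) * d i ^ 2
      ≤ 4 / (τ + μ.real {i}) * d i ^ 2 := by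
        gcongr
        exact mul_integral_inverseFreq_sq_le hsτ i
    _ = 4 * (d i ^ 2 / (τ + μ.real {i})) := by ring

theorem measureReal_lt_sum_inverseFreq_sq_le (hsτ : 1 ≤ s * τ) (d : α → ℝ) {δ : ℝ} (hδ : 0 < δ) :
    (iidLaw μ s).real {x | 4 / δ ^ 2 * ∑ i, inverseFreq τ x i * d i ^ 2 <
      ∑ i, μ.real {i} * inverseFreq τ x i ^ 2 * d i ^ 2} ≤ 2 * δ := by
  obtain ⟨-, hτ⟩ := pos_and_pos_of_one_le_natCast_mul hsτ
  have hw (x : Fin s → α) (i : α) : 0 < inverseFreq τ x i := inverseFreq_pos hτ x i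
  set σ := ∑ i, d i ^ 2 / (τ + μ.real {i})
  let S (x : Fin s → α) := ∑ i, inverseFreq τ x i * d i ^ 2
  let D (x : Fin s → α) := ∑ i, (d i / (τ + μ.real {i})) ^ 2 / inverseFreq τ x i
  let R (x : Fin s → α) := ∑ i, μ.real {i} * inverseFreq τ x i ^ 2 * d i ^ 2
  have hσ : 0 ≤ σ := by positivity
  have hD : (iidLaw μ s).real {x | σ / δ < D x} ≤ δ :=
    measureReal_lt_le_of_integral_le
      (fun x => Finset.sum_nonneg fun i _ => div_nonneg (sq_nonneg _) (hw x i).le) .of_finite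
      (by positivity) hδ.le
      (by rw [mul_div_cancel₀ _ hδ.ne', integral_sum_sq_div_inverseFreq hsτ])
  have hR : (iidLaw μ s).real {x | 4 * σ / δ < R x} ≤ δ :=
    measureReal_lt_le_of_integral_le (fun x => Finset.sum_nonneg fun i _ => by positivity)
      .of_finite (by positivity) hδ.le
      (by rw [mul_div_cancel₀ _ hδ.ne']; exact integral_sum_mul_inverseFreq_sq_le hsτ d)
  have hsub : {x | 4 / δ ^ 2 * S x < R x} ⊆ {x | σ / δ < D x} ∪ {x | 4 * σ / δ < R x} := by
    intro x hx
    by_contra hgood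
    obtain ⟨hDx, hRx⟩ := not_or.1 hgood
    have hS : 0 ≤ S x := Finset.sum_nonneg fun i _ => mul_nonneg (hw x i).le (sq_nonneg _)
    have hσS : σ ≤ S x / δ := le_div_of_sq_le_mul hσ hS hδ.le
      (sq_sum_sq_div_le (fun i => hw x i) d _) (not_lt.1 hDx)
    refine not_le_of_gt (a := 4 / δ ^ 2 * S x) hx ?_
    calc R x ≤ 4 * σ / δ := not_lt.1 hRx
      _ ≤ 4 * (S x / δ) / δ := by gcongr
      _ = 4 / δ ^ 2 * S x := by ring
  calc _ ≤ _ := measureReal_mono hsub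
    _ ≤ _ := measureReal_union_le _ _
    _ ≤ δ + δ := add_le_add hD hR
    _ = 2 * δ := by ring

end InverseFreq

section Separation

variable {α : Type*} [MeasurableSpace α] {s m : ℕ}

/-- The difference between the mean of `f` under `μ` and its mean under `ν`. -/
noncomputable def meanGap (μ ν : Measure α) (f : α → ℝ) : ℝ :=
  ∫ a, f a ∂μ - ∫ a, f a ∂ν

/-- The mean of `f` under `μ` exceeds its mean under `ν` by several standard deviations of the
average of `f` over `m` samples. -/
def Separates (μ ν : Measure α) (m : ℕ) (f : α → ℝ) : Prop :=
  0 < meanGap μ ν f ∧ 36 * (∫ a, f a ^ 2 ∂μ + ∫ a, f a ^ 2 ∂ν) < m * meanGap μ ν f ^ 2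

/-- The `w`-weighted squared distance between the mass functions of `μ` and `ν`. -/
noncomputable def weightedSqDist [Fintype α] (w : α → ℝ) (μ ν : Measure α) : ℝ :=
  ∑ i, w i * (μ.real {i} - ν.real {i}) ^ 2

/-- The test function whose mean under the empirical distribution of the sample `x`, minus its
mean under `ν`, is the `w`-weighted squared distance between the two. -/
noncomputable def weightedExcess (w : α → ℝ) (ν : Measure α) (x : Fin s → α) (i : α) : ℝ :=
  w i * (empiricalFreq x i - ν.real {i})

variable {μ ν : Measure α} {w : α → ℝ}

theorem separates_of_sub_sq_le {f : α → ℝ} {S : ℝ} (hS : 0 < S) (hm : 0 < m)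
    (hgap : (meanGap μ ν f - S) ^ 2 ≤ S ^ 2 / 9)
    (hmoments : ∫ a, f a ^ 2 ∂μ + ∫ a, f a ^ 2 ∂ν ≤ m * S ^ 2 / 144) : Separates μ ν m f := by
  have hm' : (0 : ℝ) < m := by positivity
  have hG : 2 * S / 3 ≤ meanGap μ ν f := by
    have := abs_le_of_sq_le_sq' (a := meanGap μ ν f - S) (b := S / 3) (by linarith) (by positivity)
    linarith
  refine ⟨by linarith, ?_⟩
  have hstrict : 36 * (m * S ^ 2 / 144) < m * (2 * S / 3) ^ 2 := by
    nlinarith [mul_pos hm' (sq_pos_of_pos hS)]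
  calc _ ≤ 36 * (m * S ^ 2 / 144) := by gcongr
    _ < m * (2 * S / 3) ^ 2 := hstrict
    _ ≤ m * meanGap μ ν f ^ 2 := by gcongr

variable [MeasurableSingletonClass α] [IsProbabilityMeasure μ]

theorem integral_weightedExcess_sq_le (hs : s ≠ 0) (i : α) :
    ∫ x, weightedExcess w ν x i ^ 2 ∂iidLaw μ s ≤
      w i ^ 2 * (μ.real {i} / s + (μ.real {i} - ν.real {i}) ^ 2) := by
  simp only [weightedExcess, mul_pow]
  rw [integral_const_mul]
  gcongr
  exact integral_empiricalFreq_sub_sq_le hs i _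

variable [Fintype α] [IsProbabilityMeasure ν] {τ β : ℝ}

theorem meanGap_eq_sum (f : α → ℝ) :
    meanGap μ ν f = ∑ i, (μ.real {i} - ν.real {i}) * f i := by
  simp only [meanGap, integral_fintype .of_finite, smul_eq_mul, sub_mul, Finset.sum_sub_distrib]

theorem meanGap_weightedExcess_sub (w : α → ℝ) (x : Fin s → α) :
    meanGap μ ν (weightedExcess w ν x) - weightedSqDist w μ ν =
      empiricalMean (fun i => w i * (μ.real {i} - ν.real {i})) x -
        ∫ i, w i * (μ.real {i} - ν.real {i}) ∂μ := by
  rw [weightedSqDist, meanGap_eq_sum, ← sum_mul_empiricalFreq, integral_fintype .of_finite,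
    ← Finset.sum_sub_distrib, ← Finset.sum_sub_distrib]
  refine Finset.sum_congr rfl fun i _ => ?_
  rw [weightedExcess, smul_eq_mul]
  ring

theorem measureReal_lt_meanGap_weightedExcess_sub_sq_le (hs : s ≠ 0) {c δ : ℝ} (hc : 0 ≤ c)
    (hδ : 0 ≤ δ)
    (h : weightedSqDist (fun i => μ.real {i} * w i ^ 2) μ ν ≤ δ * (s * c)) :
    (iidLaw μ s).real {x | c < (meanGap μ ν (weightedExcess w ν x) -
      weightedSqDist w μ ν) ^ 2} ≤ δ := by
  simp only [meanGap_weightedExcess_sub]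
  refine measureReal_lt_empiricalMean_sub_sq_le hs .of_discrete hc hδ ?_
  simpa only [weightedSqDist, integral_fintype .of_finite, smul_eq_mul, mul_pow, ← mul_assoc]
    using h

theorem weighted_moment_le {p q w s τ β : ℝ} (hp : 0 ≤ p) (hq : 0 ≤ q) (hs : 0 < s) (hτ : 0 < τ)
    (hw : 0 ≤ w) (hwτ : w * τ ≤ 1) (hqβ : q ≤ β) (hβτ : β ≤ τ) (hsτ : 1 ≤ s * τ) :
    (p + q) * (w ^ 2 * (p / s + (p - q) ^ 2)) ≤
      p * w ^ 2 * (p - q) ^ 2 + 3 * (w * (p - q) ^ 2) + β / (s * τ ^ 2) * (p + 2 * q) := by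
  have hwq : w * q ≤ 1 := (mul_le_mul_of_nonneg_left (hqβ.trans hβτ) hw).trans hwτ
  have hws : w / s ≤ 1 := by
    rw [div_le_one hs]
    nlinarith
  have hws2 : w ^ 2 / s ≤ 1 / (s * τ ^ 2) := by
    rw [div_le_div_iff₀ hs (by positivity)]
    nlinarith [pow_le_one₀ (n := 2) (mul_nonneg hw hτ.le) hwτ]
  have hp2 : p ^ 2 + q * p ≤ 2 * (p - q) ^ 2 + (p + 2 * q) * q := by
    nlinarith [sq_nonneg (p - 2 * q)]
  calc (p + q) * (w ^ 2 * (p / s + (p - q) ^ 2))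
      = p * w ^ 2 * (p - q) ^ 2 + w * q * (w * (p - q) ^ 2) + w ^ 2 / s * (p ^ 2 + q * p) := by
        field_simp
        ring
    _ ≤ p * w ^ 2 * (p - q) ^ 2 + w * q * (w * (p - q) ^ 2) +
          w ^ 2 / s * (2 * (p - q) ^ 2 + (p + 2 * q) * q) := by gcongr
    _ = p * w ^ 2 * (p - q) ^ 2 + w * q * (w * (p - q) ^ 2) + 2 * (w / s) * (w * (p - q) ^ 2) +
          (p + 2 * q) * (w ^ 2 / s) * q := by ring
    _ ≤ p * w ^ 2 * (p - q) ^ 2 + 1 * (w * (p - q) ^ 2) + 2 * 1 * (w * (p - q) ^ 2) +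
          (p + 2 * q) * (1 / (s * τ ^ 2)) * β := by gcongr
    _ = _ := by ring

theorem integral_moments_weightedExcess_le (hw : ∀ i, 0 ≤ w i) (hwτ : ∀ i, w i * τ ≤ 1)
    (hβ : ∀ i, ν.real {i} ≤ β) (hβτ : β ≤ τ) (hsτ : 1 ≤ s * τ) :
    ∫ x, (∫ i, weightedExcess w ν x i ^ 2 ∂μ + ∫ i, weightedExcess w ν x i ^ 2 ∂ν) ∂iidLaw μ s ≤
      weightedSqDist (fun i => μ.real {i} * w i ^ 2) μ ν +
        3 * weightedSqDist w μ ν + 3 * β / (s * τ ^ 2) := by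
  obtain ⟨hs', hτ⟩ := pos_and_pos_of_one_le_natCast_mul hsτ
  have hs : s ≠ 0 := by exact_mod_cast hs'.ne'
  calc ∫ x, (∫ i, weightedExcess w ν x i ^ 2 ∂μ + ∫ i, weightedExcess w ν x i ^ 2 ∂ν) ∂iidLaw μ s
      = ∑ i, (μ.real {i} + ν.real {i}) * ∫ x, weightedExcess w ν x i ^ 2 ∂iidLaw μ s := by
        simp only [integral_fintype (μ := μ) .of_finite, integral_fintype (μ := ν) .of_finite,
          smul_eq_mul, ← Finset.sum_add_distrib, ← add_mul]
        rw [integral_finsetSum _ fun _ _ => .of_finite]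
        simp only [integral_const_mul]
    _ ≤ ∑ i, (μ.real {i} * w i ^ 2 * (μ.real {i} - ν.real {i}) ^ 2 +
          3 * (w i * (μ.real {i} - ν.real {i}) ^ 2) +
          β / (s * τ ^ 2) * (μ.real {i} + 2 * ν.real {i})) := by
        refine Finset.sum_le_sum fun i _ => ?_
        exact (mul_le_mul_of_nonneg_left (integral_weightedExcess_sq_le hs i) (by positivity)).trans
          (weighted_moment_le measureReal_nonneg measureReal_nonneg hs' hτ (hw i) (hwτ i) (hβ i)
            hβτ hsτ)
    _ = _ := by
        simp only [weightedSqDist, Finset.sum_add_distrib, ← Finset.mul_sum,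
          sum_measureReal_singleton, Finset.coe_univ, probReal_univ]
        ring

theorem measureReal_not_separates_weightedExcess_le (hm : 0 < m) (hms : m ≤ s)
    (hw : ∀ i, 0 ≤ w i) (hwτ : ∀ i, w i * τ ≤ 1) (hβ : ∀ i, ν.real {i} ≤ β) (hβτ : β ≤ τ)
    (hsτ : 1 ≤ s * τ)
    (hR : weightedSqDist (fun i => μ.real {i} * w i ^ 2) μ ν ≤ 20736 * weightedSqDist w μ ν)
    (hmS : 6 * 10 ^ 8 ≤ m * weightedSqDist w μ ν)
    (hmS2 : 10 ^ 5 * β ≤ m * s * (τ * weightedSqDist w μ ν) ^ 2) :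
    (iidLaw μ s).real {x | ¬ Separates μ ν m (weightedExcess w ν x)} ≤ 1 / 36 := by
  have hm' : (0 : ℝ) < m := by positivity
  have hms' : (m : ℝ) ≤ s := by exact_mod_cast hms
  obtain ⟨hs', hτ⟩ := pos_and_pos_of_one_le_natCast_mul hsτ
  have hs : s ≠ 0 := by exact_mod_cast hs'.ne'
  set S := weightedSqDist w μ ν
  have hS : 0 < S := pos_of_mul_pos_right (by linarith) hm'.le
  let V (x : Fin s → α) :=
    ∫ i, weightedExcess w ν x i ^ 2 ∂μ + ∫ i, weightedExcess w ν x i ^ 2 ∂ν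
  have hgap : (iidLaw μ s).real
      {x | S ^ 2 / 9 < (meanGap μ ν (weightedExcess w ν x) - S) ^ 2} ≤ 1 / 72 := by
    refine measureReal_lt_meanGap_weightedExcess_sub_sq_le hs (by positivity) (by norm_num)
      (hR.trans ?_)
    nlinarith
  have hV : (iidLaw μ s).real {x | m * S ^ 2 / 144 < V x} ≤ 1 / 72 := by
    refine measureReal_lt_le_of_integral_le (fun x => by positivity) .of_finite (by positivity)
      (by norm_num) ?_
    have hβS : 3 * β / (s * τ ^ 2) ≤ 3 * (m * S ^ 2) / 10 ^ 5 := by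
      rw [div_le_div_iff₀ (by positivity) (by positivity)]
      linarith
    have := integral_moments_weightedExcess_le (μ := μ) hw hwτ hβ hβτ hsτ
    nlinarith
  calc _ ≤ (iidLaw μ s).real
        ({x | S ^ 2 / 9 < (meanGap μ ν (weightedExcess w ν x) - S) ^ 2} ∪
          {x | m * S ^ 2 / 144 < V x}) := by
        refine measureReal_mono fun x hx => ?_
        by_contra hgood
        obtain ⟨hgapx, hVx⟩ := not_or.1 hgood
        exact hx (separates_of_sub_sq_le hS hm (not_lt.1 hgapx) (not_lt.1 hVx))
    _ ≤ _ := measureReal_union_le _ _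
    _ ≤ 1 / 72 + 1 / 72 := add_le_add hgap hV
    _ = 1 / 36 := by norm_num

end Separation

section TestFunction

variable {α : Type*} [Fintype α] {s m : ℕ}

theorem sq_sum_abs_le {τ : ℝ} (hsτ : 1 ≤ s * τ) (x : Fin s → α) (d : α → ℝ) :
    (∑ i, |d i|) ^ 2 ≤ (Fintype.card α * τ + 1) * ∑ i, inverseFreq τ x i * d i ^ 2 := by
  obtain ⟨hs, hτ⟩ := pos_and_pos_of_one_le_natCast_mul hsτ
  have hpos (i : α) : 0 < τ + empiricalFreq x i :=
    add_pos_of_pos_of_nonneg hτ (empiricalFreq_nonneg x i)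
  have hfreq : ∑ i, empiricalFreq x i = 1 := by
    simpa [empiricalMean, hs.ne'] using sum_mul_empiricalFreq (fun _ => 1) x
  have hsum : ∑ i, (τ + empiricalFreq x i) = Fintype.card α * τ + 1 := by
    simp [Finset.sum_add_distrib, hfreq]
  rw [← hsum]
  refine Finset.sum_sq_le_sum_mul_sum_of_sq_le_mul _ (fun i _ => (hpos i).le)
    (fun i _ => mul_nonneg (inverseFreq_pos hτ x i).le (sq_nonneg _)) fun i _ => ?_
  rw [sq_abs, inverseFreq, mul_inv_cancel_left₀ (hpos i).ne']

/-- The regularisation of the empirical frequencies of `s` samples on the alphabet `α`. -/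
noncomputable def regularization (α : Type*) [Fintype α] (s : ℕ) : ℝ :=
  max (Fintype.card α : ℝ)⁻¹ (s : ℝ)⁻¹

theorem one_le_mul_regularization (hs : s ≠ 0) : 1 ≤ s * regularization α s := by
  calc (1 : ℝ) = s * (s : ℝ)⁻¹ := (mul_inv_cancel₀ (by exact_mod_cast hs)).symm
    _ ≤ s * regularization α s := by
        gcongr
        exact le_max_right _ _

theorem one_le_card_mul_regularization [Nonempty α] : 1 ≤ Fintype.card α * regularization α s := by
  calc (1 : ℝ) = Fintype.card α * (Fintype.card α : ℝ)⁻¹ := (mul_inv_cancel₀ (by positivity)).symm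
    _ ≤ Fintype.card α * regularization α s := by
        gcongr
        exact le_max_left _ _

theorem le_mul_of_le_card_mul_regularization_mul [Nonempty α] {ε A S : ℝ} (hε : 0 < ε) (hε1 : ε ≤ 1)
    (hs : s ≠ 0) (hS : 2 * ε ^ 2 ≤ Fintype.card α * regularization α s * S)
    (hm : A ≤ m * ε ^ 2) (hms : A * Fintype.card α ≤ m * s * ε ^ 4) : 2 * A ≤ m * S := by
  have hN : (0 : ℝ) < Fintype.card α := by positivity
  have hs' : (0 : ℝ) < s := by positivity
  rcases max_cases (Fintype.card α : ℝ)⁻¹ (s : ℝ)⁻¹ with ⟨hτ, -⟩ | ⟨hτ, -⟩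
  · rw [regularization, hτ, mul_inv_cancel₀ hN.ne', one_mul] at hS
    calc 2 * A ≤ m * (2 * ε ^ 2) := by linarith
      _ ≤ m * S := by gcongr
  · rw [regularization, hτ, ← div_eq_mul_inv, div_mul_eq_mul_div, le_div_iff₀ hs'] at hS
    refine le_of_mul_le_mul_right ?_ hN
    calc 2 * A * Fintype.card α ≤ 2 * (m * s * ε ^ 4) := by linarith
      _ ≤ 2 * (m * s * ε ^ 2) := by
          gcongr 2 * (m * s * ?_)
          exact pow_le_pow_of_le_one hε.le hε1 (by norm_num)
      _ = m * (2 * ε ^ 2 * s) := by ring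
      _ ≤ m * (Fintype.card α * S) := by gcongr
      _ = m * S * Fintype.card α := by ring

theorem le_mul_sq_of_le_card_mul_regularization_mul [Nonempty α] {ε A S : ℝ}
    (hS : 2 * ε ^ 2 ≤ Fintype.card α * regularization α s * S)
    (hms : A * Fintype.card α ≤ m * s * ε ^ 4) :
    4 * A * (Fintype.card α : ℝ)⁻¹ ≤ m * s * (regularization α s * S) ^ 2 := by
  have hN : (0 : ℝ) < Fintype.card α := by positivity
  rw [← div_eq_mul_inv, div_le_iff₀ hN]
  refine le_of_mul_le_mul_right ?_ hN
  calc 4 * A * Fintype.card α ≤ m * s * (2 * ε ^ 2) ^ 2 := by linarith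
    _ ≤ m * s * (Fintype.card α * regularization α s * S) ^ 2 := by gcongr
    _ = _ := by ring

variable [MeasurableSpace α]

/-- The test function built from two samples: the second sample supplies the direction of
`μ - ν`, the first one the weights that flatten the heavy points of `μ`. -/
noncomputable def testFunction (ν : Measure α) (z : (Fin s → α) × (Fin s → α)) : α → ℝ :=
  weightedExcess (inverseFreq (regularization α s) z.1) ν z.2

theorem two_mul_sq_le_card_mul_weightedSqDist [Nonempty α] {μ ν : Measure α} {ε : ℝ} (hs : s ≠ 0)
    (hε : 0 ≤ ε) (hμν : 2 * ε ≤ ∑ i, |μ.real {i} - ν.real {i}|) (x : Fin s → α) :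
    2 * ε ^ 2 ≤ Fintype.card α * regularization α s *
      weightedSqDist (inverseFreq (regularization α s) x) μ ν := by
  have hsτ := one_le_mul_regularization (α := α) hs
  obtain ⟨-, hτ⟩ := pos_and_pos_of_one_le_natCast_mul hsτ
  set S := weightedSqDist (inverseFreq (regularization α s) x) μ ν
  have hS : 0 ≤ S :=
    Finset.sum_nonneg fun i _ => mul_nonneg (inverseFreq_pos hτ x i).le (sq_nonneg _)
  have hCS : (2 * ε) ^ 2 ≤ (Fintype.card α * regularization α s + 1) * S :=
    (pow_le_pow_left₀ (by positivity) hμν 2).trans (sq_sum_abs_le hsτ x _)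
  nlinarith [one_le_card_mul_regularization (α := α) (s := s)]

theorem measureReal_not_separates_testFunction_le [MeasurableSingletonClass α] [Nonempty α]
    {μ ν : Measure α} [IsProbabilityMeasure μ] [IsProbabilityMeasure ν] {ε : ℝ}
    (hν : ∀ i, ν.real {i} ≤ (Fintype.card α : ℝ)⁻¹) (hε : 0 < ε) (hε1 : ε ≤ 1)
    (hμν : 2 * ε ≤ ∑ i, |μ.real {i} - ν.real {i}|) (hm : 0 < m) (hms : m ≤ s)
    (hmε : 3 * 10 ^ 8 ≤ m * ε ^ 2) (hmsε : 3 * 10 ^ 8 * Fintype.card α ≤ m * s * ε ^ 4) :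
    ((iidLaw μ s).prod (iidLaw μ s)).real {z | ¬ Separates μ ν m (testFunction ν z)} ≤ 1 / 18 := by
  have hs : s ≠ 0 := (hm.trans_le hms).ne'
  have hsτ := one_le_mul_regularization (α := α) hs
  obtain ⟨-, hτ⟩ := pos_and_pos_of_one_le_natCast_mul hsτ
  have hnoise := measureReal_lt_sum_inverseFreq_sq_le (μ := μ) hsτ
    (fun i => μ.real {i} - ν.real {i}) (by norm_num : (0 : ℝ) < 1 / 72)
  refine (measureReal_prod_le_add .of_discrete .of_discrete hnoise (by norm_num : (0 : ℝ) ≤ 1 / 36)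
    fun x hx => ?_).trans (by norm_num)
  have hS := two_mul_sq_le_card_mul_weightedSqDist hs hε.le hμν x
  refine measureReal_not_separates_weightedExcess_le hm hms (fun i => (inverseFreq_pos hτ x i).le)
    (fun i => ?_) hν (le_max_left _ _) hsτ ?_ ?_ ?_
  · exact (mul_le_mul_of_nonneg_right (inverseFreq_le_inv hτ x i) hτ.le).trans_eq
      (inv_mul_cancel₀ hτ.ne')
  · refine (not_lt.1 hx).trans_eq ?_
    norm_num [weightedSqDist]
  · linarith [le_mul_of_le_card_mul_regularization_mul hε hε1 hs hS hmε hmsε]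
  · refine le_trans ?_ (le_mul_sq_of_le_card_mul_regularization_mul hS hmsε)
    gcongr
    norm_num

end TestFunction

section Vote

variable {α : Type*} [MeasurableSpace α] {m : ℕ}

/-- The samples whose average of `f` exceeds the mean of `f` under `ν` by more than three times
its standard deviation under `ν` (with the second moment in place of the variance). -/
def deviationRegion (ν : Measure α) (m : ℕ) (f : α → ℝ) : Set (Fin m → α) :=
  {y | 3 * √((∫ a, f a ^ 2 ∂ν) / m) < empiricalMean f y - ∫ a, f a ∂ν}

theorem measureReal_deviationRegion_le {ν : Measure α} [IsProbabilityMeasure ν] {f : α → ℝ}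
    (hm : m ≠ 0) (hf : MemLp f 2 ν) : (iidLaw ν m).real (deviationRegion ν m f) ≤ 1 / 9 := by
  have hm' : (m : ℝ) ≠ 0 := by exact_mod_cast hm
  have hV : 0 ≤ (∫ a, f a ^ 2 ∂ν) / m :=
    div_nonneg (integral_nonneg fun _ => sq_nonneg _) m.cast_nonneg
  calc (iidLaw ν m).real (deviationRegion ν m f)
      ≤ (iidLaw ν m).real
          {y | 9 * ((∫ a, f a ^ 2 ∂ν) / m) < (empiricalMean f y - ∫ a, f a ∂ν) ^ 2} := by
        refine measureReal_mono fun y hy => ?_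
        have hy : 3 * √((∫ a, f a ^ 2 ∂ν) / m) < empiricalMean f y - ∫ a, f a ∂ν := hy
        calc 9 * ((∫ a, f a ^ 2 ∂ν) / m) = (3 * √((∫ a, f a ^ 2 ∂ν) / m)) ^ 2 := by
              rw [mul_pow, Real.sq_sqrt hV]
              norm_num
          _ < _ := by gcongr
    _ ≤ 1 / 9 := by
        refine measureReal_lt_empiricalMean_sub_sq_le hm hf (by positivity) (by norm_num)
          (le_of_eq ?_)
        field_simp

theorem Separates.measureReal_compl_deviationRegion_le {μ ν : Measure α} [IsProbabilityMeasure μ]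
    {f : α → ℝ} (h : Separates μ ν m f) (hm : m ≠ 0) (hf : MemLp f 2 μ) :
    (iidLaw μ m).real (deviationRegion ν m f)ᶜ ≤ 1 / 9 := by
  obtain ⟨hgap, hmoments⟩ := h
  have hm' : (0 : ℝ) < m := by positivity
  have hμ : 0 ≤ ∫ a, f a ^ 2 ∂μ := integral_nonneg fun _ => sq_nonneg _
  have hν : 0 ≤ ∫ a, f a ^ 2 ∂ν := integral_nonneg fun _ => sq_nonneg _
  have hthreshold : 3 * √((∫ a, f a ^ 2 ∂ν) / m) < meanGap μ ν f / 2 := by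
    rw [← lt_div_iff₀' (by norm_num), Real.sqrt_lt' (by positivity), div_lt_iff₀ hm']
    linarith
  calc (iidLaw μ m).real (deviationRegion ν m f)ᶜ
      ≤ (iidLaw μ m).real
          {y | meanGap μ ν f ^ 2 / 4 < (empiricalMean f y - ∫ a, f a ∂μ) ^ 2} := by
        refine measureReal_mono fun y hy => ?_
        have hy : empiricalMean f y - ∫ a, f a ∂ν ≤ _ := not_lt.1 hy
        have hdev : meanGap μ ν f / 2 < ∫ a, f a ∂μ - empiricalMean f y := by
          rw [meanGap] at hthreshold ⊢
          linarith
        calc meanGap μ ν f ^ 2 / 4 = (meanGap μ ν f / 2) ^ 2 := by ring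
          _ < (∫ a, f a ∂μ - empiricalMean f y) ^ 2 := by gcongr
          _ = _ := by ring
    _ ≤ 1 / 9 :=
        measureReal_lt_empiricalMean_sub_sq_le hm hf (by positivity) (by norm_num) (by linarith)

end Vote

section Majority

variable {ι Ω : Type*} [Fintype ι]

open scoped Classical in
/-- More than half of the entries of `y` lie in `W`. -/
def IsMajority (W : Set Ω) (y : ι → Ω) : Prop :=
  Fintype.card ι < 2 * (Finset.univ.filter fun b => y b ∈ W).card

variable [MeasurableSpace Ω] {μ : Measure Ω} [IsProbabilityMeasure μ] {W : Set Ω}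

open scoped Classical in
/-- A Chernoff bound, with exponential weight `2` on the entries in `W` and `1 / 2` on the
others. -/
theorem measureReal_card_le_two_mul_card_mem_le (hW : MeasurableSet W) (h : μ.real W ≤ 1 / 9) :
    (Measure.pi fun _ : ι => μ).real
      {y | Fintype.card ι ≤ 2 * (Finset.univ.filter fun b => y b ∈ W).card} ≤
      (2 / 3) ^ Fintype.card ι := by
  let g : Ω → ℝ := fun a => W.indicator (fun _ => 3 / 2) a + 1 / 2
  have hind : Integrable (W.indicator fun _ => (3 / 2 : ℝ)) μ := (integrable_const _).indicator hW
  have hg0 : ∀ a, 0 ≤ g a := fun a =>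
    add_nonneg (Set.indicator_nonneg (fun _ _ => by norm_num) a) (by norm_num)
  have hint : Integrable (fun y : ι → Ω => ∏ b, g (y b)) (Measure.pi fun _ => μ) :=
    Integrable.fintype_prod fun _ => hind.add (integrable_const _)
  have hmean : ∫ a, g a ∂μ ≤ 2 / 3 := by
    rw [integral_add hind (integrable_const _), integral_indicator_const _ hW]
    simp only [smul_eq_mul, integral_const, probReal_univ]
    linarith
  have hprod (y : ι → Ω) (hy : Fintype.card ι ≤ 2 * (Finset.univ.filter fun b => y b ∈ W).card) :
      1 ≤ ∏ b, g (y b) := by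
    have hsplit := Finset.card_filter_add_card_filter_not (s := Finset.univ) fun b => y b ∈ W
    rw [Finset.card_univ] at hsplit
    calc (1 : ℝ) ≤ 2 ^ (Finset.univ.filter fun b => y b ∈ W).card *
            (1 / 2) ^ (Finset.univ.filter fun b => y b ∉ W).card := by
          rw [one_div_pow, mul_one_div, one_le_div (by positivity)]
          exact pow_le_pow_right₀ (by norm_num) (by lia)
      _ = ∏ b, if y b ∈ W then (2 : ℝ) else 1 / 2 := by
          simp only [Finset.prod_ite, Finset.prod_const]
      _ = ∏ b, g (y b) := Finset.prod_congr rfl fun b _ => by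
          by_cases hb : y b ∈ W <;> norm_num [g, hb]
  calc _ ≤ (Measure.pi fun _ : ι => μ).real {y | 1 ≤ ∏ b, g (y b)} := measureReal_mono hprod
    _ ≤ ∫ y : ι → Ω, ∏ b, g (y b) ∂Measure.pi fun _ => μ := by
        simpa using mul_meas_ge_le_integral_of_nonneg
          (ae_of_all _ fun y => Finset.prod_nonneg fun b _ => hg0 (y b)) hint 1
    _ = (∫ a, g a ∂μ) ^ Fintype.card ι := integral_fintype_prod_eq_pow g
    _ ≤ (2 / 3) ^ Fintype.card ι := by
        gcongr
        exact integral_nonneg hg0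

theorem measureReal_isMajority_le (hW : MeasurableSet W) (h : μ.real W ≤ 1 / 9) :
    (Measure.pi fun _ : ι => μ).real {y | IsMajority W y} ≤ (2 / 3) ^ Fintype.card ι :=
  (measureReal_mono fun _ (hy : IsMajority W _) => le_of_lt hy).trans
    (measureReal_card_le_two_mul_card_mem_le hW h)

theorem measureReal_not_isMajority_le (hW : MeasurableSet W) (h : μ.real Wᶜ ≤ 1 / 9) :
    (Measure.pi fun _ : ι => μ).real {y | ¬ IsMajority W y} ≤ (2 / 3) ^ Fintype.card ι := by
  classical
  refine (measureReal_mono fun y hy => ?_).trans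
    (measureReal_card_le_two_mul_card_mem_le hW.compl h)
  have hsplit := Finset.card_filter_add_card_filter_not (s := Finset.univ) fun b => y b ∈ W
  have hy : 2 * (Finset.univ.filter fun b => y b ∈ W).card ≤ Fintype.card ι := not_lt.1 hy
  rw [Finset.card_univ] at hsplit
  simp only [Set.mem_ofPred_eq, Set.mem_compl_iff]
  lia

end Majority

section Batches

variable {α : Type*}

/-- The two halves of a sample of size `s + s`. -/
def halves {s : ℕ} (x : Fin (s + s) → α) : (Fin s → α) × (Fin s → α) :=
  (fun j => x (Fin.castAdd s j), fun j => x (Fin.natAdd s j))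

/-- A sample of size `t * m` cut into `t` batches of size `m`. -/
def batches {t m : ℕ} (y : Fin (t * m) → α) : Fin t → Fin m → α :=
  fun b j => y (finProdFinEquiv (b, j))

variable [MeasurableSpace α] (μ : Measure α) [IsProbabilityMeasure μ]

theorem measurePreserving_halves (s : ℕ) :
    MeasurePreserving halves (iidLaw μ (s + s)) ((iidLaw μ s).prod (iidLaw μ s)) :=
  (measurePreserving_sumPiEquivProdPi fun _ : Fin s ⊕ Fin s => μ).comp
    (measurePreserving_arrowCongr' _ _ finSumFinEquiv.symm (.refl α) fun _ => .id μ)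

theorem measurePreserving_curry (ι κ : Type*) [Fintype ι] [Fintype κ] :
    MeasurePreserving (MeasurableEquiv.curry ι κ α) (Measure.pi fun _ => μ)
      (Measure.pi fun _ => Measure.pi fun _ => μ) where
  measurable := MeasurableEquiv.measurable _
  map_eq := by simpa only [Measure.infinitePi_eq_pi] using
    Measure.infinitePi_map_curry fun (_ : ι) (_ : κ) => μ

theorem measurePreserving_batches (t m : ℕ) :
    MeasurePreserving batches (iidLaw μ (t * m)) (Measure.pi fun _ : Fin t => iidLaw μ m) :=
  (measurePreserving_curry μ (Fin t) (Fin m)).comp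
    (measurePreserving_arrowCongr' _ _ finProdFinEquiv.symm (.refl α) fun _ => .id μ)

end Batches

section Classification

variable {α ι : Type*} [Fintype ι] [MeasurableSpace α] {μ ν : Measure α} [IsProbabilityMeasure μ]
  [IsProbabilityMeasure ν] {s t m : ℕ}

theorem measureReal_pi_exists_mem_le {Ω : Type*} [MeasurableSpace Ω] {κ : ι → Measure Ω}
    [∀ i, IsProbabilityMeasure (κ i)] {B : ι → Set Ω} (hB : ∀ i, MeasurableSet (B i)) {b : ℝ}
    (h : ∀ i, (κ i).real (B i) ≤ b) :
    (Measure.pi κ).real {y | ∃ i, y i ∈ B i} ≤ Fintype.card ι * b := by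
  calc (Measure.pi κ).real {y | ∃ i, y i ∈ B i}
      = (Measure.pi κ).real (⋃ i, Function.eval i ⁻¹' B i) := by
        simp only [Set.preimage, Function.eval, Set.iUnion_ofPred]
    _ ≤ ∑ i, (Measure.pi κ).real (Function.eval i ⁻¹' B i) := measureReal_iUnion_fintype_le _
    _ = ∑ i, (κ i).real (B i) := Finset.sum_congr rfl fun i _ =>
        (measurePreserving_eval κ i).measureReal_preimage (hB i).nullMeasurableSet
    _ ≤ Fintype.card ι * b := by
        simpa using Finset.sum_le_card_nsmul Finset.univ _ b fun i _ => h i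

variable [MeasurableSingletonClass α]

theorem Separates.measureReal_not_isMajority_iff_le [Finite α] {f : α → ℝ} (h : Separates μ ν m f)
    (hm : m ≠ 0) (p : Prop) [Decidable p] :
    (iidLaw (if p then μ else ν) (t * m)).real
      {y | ¬ (IsMajority (deviationRegion ν m f) (batches (t := t) y) ↔ p)} ≤ (2 / 3) ^ t := by
  have hpull (ρ : Measure α) [IsProbabilityMeasure ρ] (B : Set (Fin t → Fin m → α)) :
      (iidLaw ρ (t * m)).real {y | batches y ∈ B} = (Measure.pi fun _ => iidLaw ρ m).real B :=
    (measurePreserving_batches ρ t m).measureReal_preimage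
      MeasurableSet.of_discrete.nullMeasurableSet
  by_cases hp : p
  · simp only [hp, if_true, iff_true]
    refine (hpull μ {z | ¬ IsMajority (deviationRegion ν m f) z}).trans_le ?_
    simpa using measureReal_not_isMajority_le (ι := Fin t) .of_discrete
      (h.measureReal_compl_deviationRegion_le hm .of_discrete)
  · simp only [hp, if_false, iff_false, not_not]
    refine (hpull ν {z | IsMajority (deviationRegion ν m f) z}).trans_le ?_
    simpa using measureReal_isMajority_le (ι := Fin t) .of_discrete
      (measureReal_deviationRegion_le hm .of_discrete)

variable [Fintype α]

open scoped Classical in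
/-- The indices `i` for which most of the `t` batches of the sample `d.2 i` deviate from the null
distribution `ν`, as measured by the test function built from the sample `d.1`. -/
noncomputable def majorityClass (ν : Measure α) (t m : ℕ)
    (d : (Fin (s + s) → α) × (ι → Fin (t * m) → α)) : Finset ι :=
  Finset.univ.filter fun i =>
    IsMajority (deviationRegion ν m (testFunction ν (halves d.1))) (batches (t := t) (d.2 i))

theorem measureReal_majorityClass_ne_le [Nonempty α] {ε : ℝ}
    (hν : ∀ i, ν.real {i} ≤ (Fintype.card α : ℝ)⁻¹) (hε : 0 < ε) (hε1 : ε ≤ 1)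
    (hμν : 2 * ε ≤ ∑ i, |μ.real {i} - ν.real {i}|) (hm : 0 < m) (hms : m ≤ s)
    (hmε : 3 * 10 ^ 8 ≤ m * ε ^ 2) (hmsε : 3 * 10 ^ 8 * Fintype.card α ≤ m * s * ε ^ 4)
    (χ : Finset ι) [DecidablePred (· ∈ χ)] :
    ((iidLaw μ (s + s)).prod
        (Measure.pi fun i => iidLaw (if i ∈ χ then μ else ν) (t * m))).real
      {d | majorityClass ν t m d ≠ χ} ≤ 1 / 18 + Fintype.card ι * (2 / 3) ^ t := by
  let bad : Set (Fin (s + s) → α) := {x | ¬ Separates μ ν m (testFunction ν (halves x))}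
  have hbad : (iidLaw μ (s + s)).real bad ≤ 1 / 18 :=
    ((measurePreserving_halves μ s).measureReal_preimage
      MeasurableSet.of_discrete.nullMeasurableSet).trans_le
      (measureReal_not_separates_testFunction_le hν hε hε1 hμν hm hms hmε hmsε)
  refine measureReal_prod_le_add .of_discrete .of_discrete hbad (by positivity) fun x hx => ?_
  have hsep : Separates μ ν m (testFunction ν (halves x)) := not_not.1 hx
  refine (measureReal_mono fun y hy => ?_).trans
    (measureReal_pi_exists_mem_le (fun _ => .of_discrete) fun i =>
      hsep.measureReal_not_isMajority_iff_le hm.ne' (i ∈ χ))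
  by_contra hcorrect
  refine hy (Finset.ext fun i => ?_)
  simpa only [majorityClass, Finset.mem_filter_univ] using not_not.1 fun hi => hcorrect ⟨i, hi⟩

end Classification

section Classifier

variable {n k : ℕ}

theorem toMeasure_real_singleton {α : Type*} [MeasurableSpace α] [MeasurableSingletonClass α]
    (P : PMF α) (i : α) : P.toMeasure.real {i} = (P i).toReal := by
  rw [measureReal_def, P.toMeasure_apply_singleton i (measurableSet_singleton i)]

theorem two_mul_tvDist (P Q : PMF (Fin n)) :
    2 * tvDist P Q = ∑ i, |P.toMeasure.real {i} - Q.toMeasure.real {i}| := by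
  simp only [tvDist, toMeasure_real_singleton]
  ring

variable [NeZero n]

theorem Classifier.successProb_eq_dataLaw {A : Classifier n k}
    {F : (Fin A.s₁ → Fin n) × (Fin k → Fin A.s₂ → Fin n) → Finset (Fin k)}
    (hF : ∀ d, A.output d = PMF.pure (F d)) (P : PMF (Fin n)) (χ : Finset (Fin k)) :
    A.successProb P χ = A.dataLaw P (instanceDist P χ) {d | F d = χ} := by
  rw [Classifier.successProb, ← lintegral_indicator_one MeasurableSet.of_discrete]
  simp only [hF, PMF.pure_apply, Set.indicator_apply, Set.mem_ofPred_eq, Pi.one_apply,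
    eq_comm (a := χ)]

theorem unif_toMeasure_real_singleton (i : Fin n) :
    (unif n).toMeasure.real {i} = (Fintype.card (Fin n) : ℝ)⁻¹ := by
  simp [toMeasure_real_singleton, unif]

/-- The deterministic classifier that puts an index in the output when the majority of its `t`
batches of `m` samples deviate from the uniform distribution, with the test function built from
two samples of size `s` from `P`. -/
noncomputable def majorityClassifier (n k s t m : ℕ) [NeZero n] : Classifier n k where
  s₁ := s + s
  s₂ := t * m
  output d := PMF.pure (majorityClass (unif n).toMeasure t m d)

theorem le_successProb_majorityClassifier {s t m : ℕ} {P : PMF (Fin n)} {ε : ℝ}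
    (hε : 0 < ε) (hε1 : ε ≤ 1) (hP : ε ≤ tvDist P (unif n)) (hm : 0 < m) (hms : m ≤ s)
    (hmε : 3 * 10 ^ 8 ≤ m * ε ^ 2) (hmsε : 3 * 10 ^ 8 * n ≤ m * s * ε ^ 4)
    (ht : k * (2 / 3 : ℝ) ^ t ≤ 1 / 18) (χ : Finset (Fin k)) :
    8 / 9 ≤ (majorityClassifier n k s t m).successProb P χ := by
  let D (i : Fin k) : Measure (Fin n) := if i ∈ χ then P.toMeasure else (unif n).toMeasure
  let ρ := (iidLaw P.toMeasure (s + s)).prod (Measure.pi fun i => iidLaw (D i) (t * m))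
  let F := majorityClass (s := s) (ι := Fin k) (unif n).toMeasure t m
  have hdata : (majorityClassifier n k s t m).dataLaw P (instanceDist P χ) = ρ := by
    simp only [Classifier.dataLaw, majorityClassifier, instanceDist, apply_ite PMF.toMeasure]
    rfl
  have herror : ρ.real {d | F d ≠ χ} ≤ 1 / 9 := by
    calc ρ.real {d | F d ≠ χ} ≤ 1 / 18 + Fintype.card (Fin k) * (2 / 3) ^ t :=
          measureReal_majorityClass_ne_le (fun i => (unif_toMeasure_real_singleton i).le) hε hε1
            (by rw [← two_mul_tvDist]; linarith) hm hms hmε (by simpa using hmsε) χ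
      _ ≤ 1 / 9 := by
          rw [Fintype.card_fin]
          linarith
  have hsuccess : 8 / 9 ≤ ρ.real {d | F d = χ} := by
    have := probReal_compl_eq_one_sub (μ := ρ) (s := {d | F d = χ}) .of_discrete
    rw [Set.compl_ofPred] at this
    linarith
  rw [Classifier.successProb_eq_dataLaw (F := F) (fun _ => rfl), hdata]
  calc (8 / 9 : ℝ≥0∞) = ENNReal.ofReal (8 / 9) := by
        rw [ENNReal.ofReal_div_of_pos (by norm_num)]
        simp
    _ ≤ ρ {d | F d = χ} := ENNReal.ofReal_le_of_le_toReal hsuccess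

end Classifier

section SampleSizes

theorem sqrt_le_sqrt_mul_div {c M L : ℝ} (hc : 0 ≤ c) (hL : 0 < L) (hcM : c * L ≤ M) :
    √c ≤ √(M * L) / L := by
  rw [le_div_iff₀ hL]
  refine Real.le_sqrt_of_sq_le ?_
  calc (√c * L) ^ 2 = c * L * L := by
        rw [mul_pow, Real.sq_sqrt hc]
        ring
    _ ≤ M * L := by gcongr

theorem le_ceil_div_mul {x e : ℝ} (he : 0 < e) : x ≤ ⌈x / e⌉₊ * e :=
  (div_le_iff₀ he).1 (Nat.le_ceil _)

theorem ceil_div_le_two_mul {x e : ℝ} (hx : 1 ≤ x) (he : 0 < e) (he1 : e ≤ 1) :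
    ⌈x / e⌉₊ ≤ 2 * (x / e) :=
  Nat.ceil_le_two_mul (by linarith [le_div_self (by linarith : 0 ≤ x) he he1])

theorem exists_sampleSizes_of_le {A K a b ε : ℝ} (hA : 1 ≤ A) (hAK : A ≤ K) (ha : 1 ≤ a)
    (hba : b ≤ a) (hKb : A ≤ K * b) (hε : 0 < ε) (hε1 : ε ≤ 1) :
    ∃ s m : ℕ, m ≤ s ∧ A ≤ m * ε ^ 2 ∧ A * (a * b) ≤ m * s * ε ^ 4 ∧
      s ≤ 2 * (K * a / ε ^ 2) ∧ m ≤ 2 * (K * b / ε ^ 2) := by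
  have hε2 : ε ^ 2 ≤ 1 := pow_le_one₀ hε.le hε1
  have hε2' : 0 < ε ^ 2 := by positivity
  have hK : 0 ≤ K := by linarith
  have hKa : A ≤ K * a := hAK.trans (le_mul_of_one_le_right hK ha)
  refine ⟨⌈K * a / ε ^ 2⌉₊, ⌈K * b / ε ^ 2⌉₊, Nat.ceil_mono (by gcongr),
    hKb.trans (le_ceil_div_mul hε2'), ?_, ceil_div_le_two_mul (hA.trans hKa) hε2' hε2,
    ceil_div_le_two_mul (hA.trans hKb) hε2' hε2⟩
  have hb : 0 < b := pos_of_mul_pos_right (by linarith) hK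
  calc A * (a * b) ≤ K * (K * (a * b)) :=
        mul_le_mul hAK (le_mul_of_one_le_left (by positivity) (hA.trans hAK)) (by positivity) hK
    _ = K * b * (K * a) := by ring
    _ ≤ (⌈K * b / ε ^ 2⌉₊ * ε ^ 2) * (⌈K * a / ε ^ 2⌉₊ * ε ^ 2) :=
        mul_le_mul (le_ceil_div_mul hε2') (le_ceil_div_mul hε2') (by linarith) (by positivity)
    _ = _ := by ring

theorem exists_sampleSizes {c A M L ε : ℝ} (hc : 0 < c) (hA : 1 ≤ A) (hM : 1 ≤ M) (hL : 1 ≤ L)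
    (hcM : c * L ≤ M) (hε : 0 < ε) (hε1 : ε ≤ 1) :
    ∃ s m : ℕ, m ≤ s ∧ A ≤ m * ε ^ 2 ∧ A * M ≤ m * s * ε ^ 4 ∧
      s ≤ 2 * A * (1 + 1 / √c) * (√(M * L) / ε ^ 2) ∧
      L * m ≤ 2 * A * (1 + 1 / √c) * (√(M * L) / ε ^ 2) := by
  set a := √(M * L)
  have ha : 1 ≤ a := Real.one_le_sqrt.2 (one_le_mul_of_one_le_of_one_le hM hL)
  have hprod : a * (a / L) = M := by
    rw [← mul_div_assoc, Real.mul_self_sqrt (by positivity)]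
    field_simp
  have hb : A ≤ A * (1 + 1 / √c) * (a / L) := by
    calc A ≤ A * (√c + 1) := le_mul_of_one_le_right (by positivity) (by simp)
      _ = A * (1 + 1 / √c) * √c := by field_simp
      _ ≤ A * (1 + 1 / √c) * (a / L) := by
        gcongr
        exact sqrt_le_sqrt_mul_div hc.le (by positivity) hcM
  obtain ⟨s, m, hms, hmε, hmsε, hs, hm⟩ := exists_sampleSizes_of_le hA
    (le_mul_of_one_le_right (by positivity) (by simp)) ha (div_le_self (by positivity) hL) hb hε hε1
  refine ⟨s, m, hms, hmε, hprod ▸ hmsε, hs.trans_eq (by ring), ?_⟩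
  calc L * (m : ℝ) ≤ L * (2 * (A * (1 + 1 / √c) * (a / L) / ε ^ 2)) := by gcongr
    _ = 2 * A * (1 + 1 / √c) * (a / ε ^ 2) := by field_simp

theorem mul_two_thirds_pow_le {k t : ℕ} (hk : 2 ≤ k) (ht : 18 * Real.log k ≤ t) :
    k * (2 / 3 : ℝ) ^ t ≤ 1 / 18 := by
  have hk' : (2 : ℝ) ≤ k := by exact_mod_cast hk
  have hbase : (2 / 3 : ℝ) ≤ Real.exp (-(1 / 3)) := by
    linarith [Real.add_one_le_exp (-(1 / 3) : ℝ)]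
  have hpow : (2 / 3 : ℝ) ^ t ≤ 1 / (k : ℝ) ^ 6 := by
    calc (2 / 3 : ℝ) ^ t ≤ Real.exp (-(1 / 3)) ^ t := by gcongr
      _ = Real.exp (t * -(1 / 3)) := (Real.exp_nat_mul _ _).symm
      _ ≤ Real.exp (-((6 : ℕ) * Real.log k)) := Real.exp_le_exp.2 (by push_cast; linarith)
      _ = 1 / (k : ℝ) ^ 6 := by
        rw [Real.exp_neg, Real.exp_nat_mul, Real.exp_log (by linarith), one_div]
  calc k * (2 / 3 : ℝ) ^ t ≤ k * (1 / (k : ℝ) ^ 6) := by gcongr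
    _ = 1 / (k : ℝ) ^ 5 := by field_simp
    _ ≤ 1 / 2 ^ 5 := by gcongr
    _ ≤ 1 / 18 := by norm_num

theorem exists_numBatches {k : ℕ} (hk : 2 ≤ k) :
    ∃ t : ℕ, k * (2 / 3 : ℝ) ^ t ≤ 1 / 18 ∧ t ≤ 20 * Real.log k := by
  have hlog : 1 / 2 ≤ Real.log k := by
    have hk' : (2 : ℝ) ≤ k := by exact_mod_cast hk
    linarith [Real.log_two_gt_d9, Real.log_le_log (by norm_num) hk']
  refine ⟨⌈18 * Real.log k⌉₊, mul_two_thirds_pow_le hk (Nat.le_ceil _), ?_⟩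
  linarith [Nat.ceil_lt_add_one (a := 18 * Real.log k) (by positivity)]

theorem one_le_natCast_mul_log {k : ℕ} (hk : 2 ≤ k) : 1 ≤ k * Real.log k := by
  have hk' : (2 : ℝ) ≤ k := by exact_mod_cast hk
  nlinarith [Real.log_two_gt_d9, Real.log_le_log (by norm_num) hk']

/-- `M` plays the role of `max n (c k log k)`, so that both regimes are treated at once. -/
theorem exists_classifier_samples_le {c : ℝ} (hc : 0 < c) {n k : ℕ} [NeZero n] {ε M : ℝ}
    (hk : 2 ≤ k) (hε : 0 < ε) (hε1 : ε ≤ 1) (hnM : n ≤ M) (hcM : c * (k * Real.log k) ≤ M) :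
    ∃ A : Classifier n k,
      (A.samples : ℝ) ≤
        44 * (3 * 10 ^ 8 * (1 + 1 / √c)) * (√(M * (k * Real.log k)) / ε ^ 2) ∧
      ∀ P : PMF (Fin n), ε ≤ tvDist P (unif n) →
        ∀ χ : Finset (Fin k), 8 / 9 ≤ A.successProb P χ := by
  have hn : (1 : ℝ) ≤ n := by exact_mod_cast NeZero.one_le
  obtain ⟨t, ht, htk⟩ := exists_numBatches hk
  obtain ⟨s, m, hms, hmε, hmsε, hs, hm⟩ := exists_sampleSizes (A := 3 * 10 ^ 8) hc (by norm_num)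
    (hn.trans hnM) (one_le_natCast_mul_log hk) hcM hε hε1
  have hm0 : 0 < m := Nat.pos_of_ne_zero fun h => by norm_num [h] at hmε
  refine ⟨majorityClassifier n k s t m, ?_, fun P hP χ =>
    le_successProb_majorityClassifier hε hε1 hP hm0 hms hmε ((by gcongr : _ ≤ _).trans hmsε) ht χ⟩
  calc ((majorityClassifier n k s t m).samples : ℝ) = 2 * s + k * (t * m) := by
        simp [Classifier.samples, majorityClassifier, two_mul]
    _ ≤ 2 * s + k * (20 * Real.log k * m) := by gcongr
    _ = 2 * s + 20 * (k * Real.log k * m) := by ring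
    _ ≤ _ := by linarith

end SampleSizes

theorem theorem3p2 :
    ∀ c : ℝ, 0 < c → ∃ C : ℝ, 0 < C ∧
      ∀ (n k : ℕ) [NeZero n] (ε : ℝ), 2 ≤ k → 0 < ε → ε ≤ 1 →
        ∃ A : Classifier n k,
          (c * (k * Real.log k) ≤ n →
            (A.samples : ℝ) ≤ C * (Real.sqrt (n * k * Real.log k) / ε ^ 2)) ∧
          ((n : ℝ) ≤ c * (k * Real.log k) →
            (A.samples : ℝ) ≤ C * (k * Real.log k / ε ^ 2)) ∧
          ∀ P : PMF (Fin n), ε ≤ tvDist P (unif n) →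
            ∀ χ : Finset (Fin k), 8 / 9 ≤ A.successProb P χ := by
  intro c hc
  let B := 44 * (3 * 10 ^ 8 * (1 + 1 / √c))
  refine ⟨max B (B * √c), by positivity, fun n k _ ε hk hε hε1 => ?_⟩
  obtain ⟨A, hsamples, hsuccess⟩ := exists_classifier_samples_le hc hk hε hε1
    (le_max_left (n : ℝ) (c * (k * Real.log k))) (le_max_right _ _)
  refine ⟨A, fun h => ?_, fun h => ?_, hsuccess⟩
  · rw [max_eq_left h, ← mul_assoc (n : ℝ)] at hsamples
    refine hsamples.trans ?_
    gcongr
    exact le_max_left _ _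
  · rw [max_eq_right h, mul_assoc c, Real.sqrt_mul hc.le,
      Real.sqrt_mul_self (by positivity), mul_div_assoc, ← mul_assoc] at hsamples
    refine hsamples.trans ?_
    gcongr
    exact le_max_right _ _
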